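/- Let $\Omega$ be a complete separable metric space and let $\nu$ be a Lévy measure on $\mathbb R\times\Omega$, i.e. a Borel measure with $\nu(\{0\}\times\Omega)=0$, satisfying the local $L_2$ condition $\iint_{\mathbb R\times K}(1\wedge\beta^2)\,\nu(d\beta\,d\omega)<\infty$ for every compact $K\subset\Omega$. Let $\mathcal N$ be a Poisson random measure on $\mathbb R\times\Omega$ with intensity $\nu$, defined on some probability space, and let $\tilde{\mathcal N}=\mathcal N-\nu$ be the compensated measure. The integral $\iint f\,d\tilde{\mathcal N}$ equals $\iint f\,d\mathcal N-\iint f\,d\nu$ for $f\in L_1(\nu)$ and is extended by continuity in probability to all measurable $f$ with $\iint(|f|\wedge f^2)\,d\nu<\infty$, where $f_n\to f$ means $\iint(|f-f_n|\wedge|f-f_n|^2)\,d\nu\to0$. Let $\phi:\Omega\to\mathbb R$ be a Borel measurable function satisfying $$\iint_{[-1,1]^c\times\Omega}(1\wedge|\beta\phi(\omega)|)\,\nu(d\beta\,d\omega)<\infty,\qquad \iint_{[-1,1]\times\Omega}(|\beta\phi(\omega)|\wedge|\beta\phi(\omega)|^2)\,\nu(d\beta\,d\omega)<\infty,$$ $$\iint_{\mathbb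 R\times\Omega}(1\wedge\beta^2)\,|\phi(\omega)|\,\nu(d\beta\,d\omega)<\infty .$$ Let $\{K_\varepsilon\}_{\varepsilon>0}$ be any family of compact subsets of $\Omega$ increasing to $\Omega$ as $\varepsilon\to0$ (that is, $K_{\varepsilon'}\subset K_\varepsilon$ for $0<\varepsilon\le\varepsilon'$ and $\bigcup_{\varepsilon>0}K_\varepsilon=\Omega$), let $\nu_\varepsilon$ be the restriction of $\nu$ to $[-\varepsilon,\varepsilon]^c\times K_\varepsilon$, and let $h:\mathbb R\to\mathbb R$ be any bounded measurable function with $h(\beta)=\beta+O(\beta^2)$ for $\beta$ near $0$. Then: 1. for every $\varepsilon>0$, $\nu_\varepsilon(\mathbb R\times\Omega)<\infty$ and the random variable $$\mathcal L_\varepsilon[\phi]=\iint_{[-\varepsilon,\varepsilon]^c\times K_\varepsilon}\beta\,\phi(\omega)\,\mathcal N(d\beta\,d\omega)-\iint_{[-\varepsilon,\varepsilon]^c\times K_\varepsilon}h(\beta)\,\phi(\omega)\,\nu(d\beta\,d\omega)$$ is well defined (the first integral converges absolutely almost surely, the second converges absolutely); 2. the random variable $$\mathcal L[\phi]=\iint_{\mathbb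 R\times\Omega}[\beta-h(\beta)]\,\phi(\omega)\,\mathcal N(d\beta\,d\omega)+\iint_{\mathbb R\times\Omega}h(\beta)\,\phi(\omega)\,\tilde{\mathcal N}(d\beta\,d\omega)$$ is well defined, and $\mathcal L_\varepsilon[\phi]\to\mathcal L[\phi]$ in probability as $\varepsilon\to0$. -/

import Mathlib

open MeasureTheory ProbabilityTheory Filter Topology Set Asymptotics
open scoped ENNReal NNReal

/-- A Poisson random measure on `E` with intensity `ν`, defined on the probability space `(S, P)`:
a random measure `N` such that `N C` has the Poisson law of mean `ν C` for every measurable `C`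
(`N C = ∞` a.s. when `ν C = ∞`) and such that the counts of finitely many disjoint measurable sets
are independent. -/
structure IsPoissonRandomMeasure {S E : Type*} [MeasurableSpace S] [MeasurableSpace E]
    (P : Measure S) (ν : Measure E) (N : S → Measure E) : Prop where
  measurable_apply : ∀ C : Set E, MeasurableSet C → Measurable (fun s => N s C)
  law_of_finite : ∀ C : Set E, MeasurableSet C → ν C < ∞ →
    P.map (fun s => N s C) =
      (poissonMeasure (ν C).toNNReal).map (fun k : ℕ => (k : ℝ≥0∞))
  law_of_infinite : ∀ C : Set E, MeasurableSet C → ν C = ∞ → ∀ᵐ s ∂P, N s C = ∞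
  indep : ∀ (n : ℕ) (C : Fin n → Set E), (∀ i, MeasurableSet (C i)) →
    Pairwise (fun i j => Disjoint (C i) (C j)) → iIndepFun (fun i s => N s (C i)) P

/-- `Y` is (a version of) the integral `∫ f dÑ` of `f` against the compensated Poisson measure
`Ñ = N - ν`. For `ν`-integrable `g` this integral is `∫ g dN - ∫ g dν`; it is extended by
continuity in probability to the Musielak-Orlicz space `{f : ∫ |f| ∧ f² dν < ∞}` (which contains
both `L¹(ν)` and `L²(ν)`), on which convergence `gₙ → f` is `∫ |f - gₙ| ∧ (f - gₙ)² dν → 0`. -/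
def IsCompensatedIntegral {S E : Type*} [MeasurableSpace S] [MeasurableSpace E]
    (P : Measure S) (ν : Measure E) (N : S → Measure E) (f : E → ℝ) (Y : S → ℝ) : Prop :=
  AEMeasurable Y P ∧
  ∃ g : ℕ → E → ℝ, (∀ n, Measurable (g n)) ∧ (∀ n, Integrable (g n) ν) ∧
    Tendsto (fun n => ∫⁻ p, ENNReal.ofReal (min |f p - g n p| (|f p - g n p| ^ 2)) ∂ν)
      atTop (𝓝 0) ∧
    TendstoInMeasure P (fun n s => (∫ p, g n p ∂(N s)) - ∫ p, g n p ∂ν) atTop Y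

/-- Lévy measures on `ℝ × Ω`: no mass at `β = 0`, and the local `L²` integrability condition
`∫∫_{ℝ × K} (1 ∧ β²) ν(dβ dω) < ∞` for every compact `K ⊆ Ω`. -/
structure IsLocalL2LevyMeasure {Ω : Type*} [TopologicalSpace Ω] [MeasurableSpace Ω]
    (ν : Measure (ℝ × Ω)) : Prop where
  zero : ν ({0} ×ˢ univ) = 0
  localL2 : ∀ K : Set Ω, IsCompact K →
    ∫⁻ p in univ ×ˢ K, ENNReal.ofReal (min 1 (p.1 ^ 2)) ∂ν < ∞

/-- The three integrability conditions on the integrand `φ` under which `L[φ]` is defined. -/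
structure LevyIntegrable {Ω : Type*} [MeasurableSpace Ω]
    (ν : Measure (ℝ × Ω)) (φ : Ω → ℝ) : Prop where
  large_jumps : ∫⁻ p in (Icc (-1 : ℝ) 1)ᶜ ×ˢ univ,
    ENNReal.ofReal (min 1 |p.1 * φ p.2|) ∂ν < ∞
  small_jumps : ∫⁻ p in Icc (-1 : ℝ) 1 ×ˢ univ,
    ENNReal.ofReal (min |p.1 * φ p.2| (|p.1 * φ p.2| ^ 2)) ∂ν < ∞
  drift : ∫⁻ p, ENNReal.ofReal (min 1 (p.1 ^ 2) * |φ p.2|) ∂ν < ∞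

/-- Bounded measurable compensators `h` with `h(β) = β + O(β²)` for `β` near `0`. -/
structure IsBoundedCompensator (h : ℝ → ℝ) : Prop where
  measurable : Measurable h
  bounded : ∃ c : ℝ, ∀ β, |h β| ≤ c
  near_zero : (fun β => h β - β) =O[𝓝 0] (fun β : ℝ => β ^ 2)

/-- `L` is (a version of) the Lévy random field
`L[φ] = ∫∫ (β - h(β)) φ(ω) N(dβ dω) + ∫∫ h(β) φ(ω) Ñ(dβ dω)`; both integrals must exist, the
first one almost surely as an absolutely convergent integral against the measure `N`. -/
def IsLevyField {S Ω : Type*} [MeasurableSpace S] [MeasurableSpace Ω]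
    (P : Measure S) (ν : Measure (ℝ × Ω)) (N : S → Measure (ℝ × Ω))
    (h : ℝ → ℝ) (φ : Ω → ℝ) (L : S → ℝ) : Prop :=
  (∀ᵐ s ∂P, Integrable (fun p : ℝ × Ω => (p.1 - h p.1) * φ p.2) (N s)) ∧
  ∃ Y : S → ℝ, IsCompensatedIntegral P ν N (fun p => h p.1 * φ p.2) Y ∧
    ∀ᵐ s ∂P, L s = (∫ p, (p.1 - h p.1) * φ p.2 ∂(N s)) + Y s

/-- The truncation region `[-ε, ε]ᶜ × K`. -/
def truncRegion {Ω : Type*} (ε : ℝ) (K : Set Ω) : Set (ℝ × Ω) := (Icc (-ε) ε)ᶜ ×ˢ K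

/-- The truncated Lévy measure `ν_ε`. -/
noncomputable def truncMeasure {Ω : Type*} [MeasurableSpace Ω] (ν : Measure (ℝ × Ω))
    (ε : ℝ) (K : Set Ω) : Measure (ℝ × Ω) := ν.restrict (truncRegion ε K)

theorem truncMeasure_prod {Ω : Type*} [MeasurableSpace Ω] (ν : Measure (ℝ × Ω))
    (ε : ℝ) (K : Set Ω) {B : Set ℝ} {A : Set Ω} (hB : MeasurableSet B) (hA : MeasurableSet A) :
    truncMeasure ν ε K (B ×ˢ A) = ν ((B ∩ (Icc (-ε) ε)ᶜ) ×ˢ (A ∩ K)) := by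
  rw [truncMeasure, truncRegion, Measure.restrict_apply (hB.prod hA), prod_inter_prod]

/-- The finite-measure approximation
`L_ε[φ] = ∫∫_{[-ε,ε]ᶜ × K} β φ(ω) N(dβ dω) - ∫∫_{[-ε,ε]ᶜ × K} h(β) φ(ω) ν(dβ dω)`. -/
noncomputable def levyApprox {S Ω : Type*} [MeasurableSpace Ω]
    (ν : Measure (ℝ × Ω)) (N : S → Measure (ℝ × Ω)) (h : ℝ → ℝ) (φ : Ω → ℝ)
    (ε : ℝ) (K : Set Ω) (s : S) : ℝ :=
  (∫ p in truncRegion ε K, p.1 * φ p.2 ∂(N s)) - ∫ p, h p.1 * φ p.2 ∂(truncMeasure ν ε K)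

/-! ### Moments of the Poisson law. -/

section PoissonMoments

/-! On the truncation region, βφ = (β − h)φ + hφ, so `levyApprox` splits into an honest Poisson
integral of (β − h)φ and a compensated integral of hφ, both cut off to the region. The two pieces
converge for different reasons.

The function (β − h)φ satisfies ∫ 1 ∧ |·| dν < ∞: it is O(β²)|φ| for small jumps, and the large-jump
and drift conditions handle the rest. Hence it is almost surely absolutely integrable against N
(`ae_integrable_of_lintegral_min`), and dominated convergence applies path by path.

The function hφ has finite gauge ∫ |·| ∧ |·|² dν, and its truncations converge to it in that gauge,
again by dominated convergence. What carries this piece is continuity in probability of the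
compensated integral (`exists_tail_le`, `tendstoInMeasure_compensatedInt`). Cut the integrand at
height 1: the large values are controlled in L¹ by Campbell's formula, the small ones in L² by the
Itô isometry, which rests on independence of counts on disjoint sets and on variance = mean for
Poisson laws. Existence of the compensated integral (`exists_isCompensatedIntegral`) uses the same
L² bound and completeness of L². -/

theorem hasSum_poisson_mul (r : ℝ≥0) (a : ℕ → ℝ) (m : ℝ)
    (ha : HasSum (fun n : ℕ => Real.exp (-r) * r ^ n / n.factorial * a (n + 1)) m) :
    HasSum (fun n : ℕ => Real.exp (-r) * r ^ n / n.factorial * (n * a n)) (r * m) := by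
  -- The term n = 0 vanishes, and n / n! = 1 / (n − 1)! turns the rest into the shifted series.
  rw [← hasSum_nat_add_iff' 1]
  simp only [Finset.range_one, Finset.sum_singleton, CharP.cast_eq_zero, zero_mul, mul_zero,
    sub_zero]
  convert! ha.mul_left (r : ℝ) using 2 with n
  rw [Nat.factorial_succ]
  push_cast
  field_simp
  ring

theorem hasSum_poisson_id (r : ℝ≥0) :
    HasSum (fun n : ℕ => Real.exp (-r) * r ^ n / n.factorial * (n : ℝ)) r := by
  simpa using hasSum_poisson_mul r (fun _ => 1) 1 (by simpa using hasSum_one_poissonMeasure r)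

theorem hasSum_poisson_sq (r : ℝ≥0) :
    HasSum (fun n : ℕ => Real.exp (-r) * r ^ n / n.factorial * (n : ℝ) ^ 2) (r * (r + 1)) := by
  have := hasSum_poisson_mul r (fun n => n) (r + 1) (by
    convert! (hasSum_poisson_id r).add (hasSum_one_poissonMeasure r) using 2 with n
    push_cast
    ring)
  simpa [pow_two] using this

theorem integral_natCast_poissonMeasure (r : ℝ≥0) : ∫ n : ℕ, (n : ℝ) ∂poissonMeasure r = r := by
  rw [integral_poissonMeasure]
  exact (hasSum_poisson_id r).tsum_eq

theorem memLp_natCast_poissonMeasure (r : ℝ≥0) :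
    MemLp (fun n : ℕ => (n : ℝ)) 2 (poissonMeasure r) := by
  rw [memLp_two_iff_integrable_sq (by fun_prop), integrable_poissonMeasure_iff]
  simpa using (hasSum_poisson_sq r).summable

theorem variance_natCast_poissonMeasure (r : ℝ≥0) :
    variance (fun n : ℕ => (n : ℝ)) (poissonMeasure r) = r := by
  rw [variance_eq_sub (memLp_natCast_poissonMeasure r), integral_natCast_poissonMeasure,
    integral_poissonMeasure]
  have := (hasSum_poisson_sq r).tsum_eq
  simp only [Pi.pow_apply, smul_eq_mul]
  rw [this]
  ring

end PoissonMoments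

/-! ### Counts, Campbell's formula and the isometry for simple functions. -/

namespace IsPoissonRandomMeasure

variable {S E : Type*} [MeasurableSpace S] [MeasurableSpace E]
  {P : Measure S} {ν : Measure E} {N : S → Measure E}

theorem measurable (hN : IsPoissonRandomMeasure P ν N) : Measurable N :=
  Measure.measurable_of_measurable_coe _ hN.measurable_apply

theorem measurable_real (hN : IsPoissonRandomMeasure P ν N) {C : Set E} (hC : MeasurableSet C) :
    Measurable (fun s => (N s).real C) :=
  (hN.measurable_apply C hC).ennreal_toReal

/-- The real-valued count of a set of finite intensity has a Poisson law. -/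
theorem law_real (hN : IsPoissonRandomMeasure P ν N) {C : Set E} (hC : MeasurableSet C)
    (hfin : ν C < ∞) :
    P.map (fun s => (N s).real C) =
      (poissonMeasure (ν C).toNNReal).map (fun k : ℕ => (k : ℝ)) := by
  have h1 : (fun s => (N s).real C) = ENNReal.toReal ∘ fun s => N s C := rfl
  rw [h1, ← Measure.map_map ENNReal.measurable_toReal (hN.measurable_apply C hC),
    hN.law_of_finite C hC hfin, Measure.map_map ENNReal.measurable_toReal (by fun_prop)]
  rfl

theorem memLp_real (hN : IsPoissonRandomMeasure P ν N) {C : Set E} (hC : MeasurableSet C)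
    (hfin : ν C < ∞) : MemLp (fun s => (N s).real C) 2 P := by
  have h : MemLp id 2 (P.map (fun s => (N s).real C)) := by
    rw [hN.law_real hC hfin, memLp_map_measure_iff (by fun_prop) (by fun_prop)]
    exact memLp_natCast_poissonMeasure _
  exact (memLp_map_measure_iff (by fun_prop) (hN.measurable_real hC).aemeasurable).1 h

theorem integral_real (hN : IsPoissonRandomMeasure P ν N) {C : Set E} (hC : MeasurableSet C)
    (hfin : ν C < ∞) : ∫ s, (N s).real C ∂P = ν.real C := by
  have h := integral_map (μ := P) (hN.measurable_real hC).aemeasurable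
    (f := fun x : ℝ => x) (by fun_prop)
  rw [← h, hN.law_real hC hfin, integral_map (by fun_prop) (by fun_prop),
    integral_natCast_poissonMeasure]
  rfl

theorem variance_real (hN : IsPoissonRandomMeasure P ν N) {C : Set E} (hC : MeasurableSet C)
    (hfin : ν C < ∞) : variance (fun s => (N s).real C) P = ν.real C := by
  have h := variance_map (μ := P) (X := fun x : ℝ => x) (by fun_prop)
    (hN.measurable_real hC).aemeasurable
  have h' := variance_map (μ := poissonMeasure (ν C).toNNReal) (X := fun x : ℝ => x)
    (Y := fun k : ℕ => (k : ℝ)) (by fun_prop) (by fun_prop)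
  rw [hN.law_real hC hfin, h'] at h
  refine h.symm.trans ?_
  exact variance_natCast_poissonMeasure _

theorem ae_lt_top (hN : IsPoissonRandomMeasure P ν N) {C : Set E} (hC : MeasurableSet C)
    (hfin : ν C < ∞) : ∀ᵐ s ∂P, N s C < ∞ := by
  have h : ∀ᵐ x ∂(P.map (fun s => N s C)), x < ∞ := by
    rw [hN.law_of_finite C hC hfin, ae_map_iff (by fun_prop) measurableSet_Iio]
    exact ae_of_all _ fun k => ENNReal.natCast_lt_top k
  exact ae_of_ae_map (hN.measurable_apply C hC).aemeasurable h

theorem lintegral_apply [IsProbabilityMeasure P] (hN : IsPoissonRandomMeasure P ν N) {C : Set E}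
    (hC : MeasurableSet C) : ∫⁻ s, N s C ∂P = ν C := by
  rcases eq_or_ne (ν C) ∞ with h | h
  · rw [lintegral_congr_ae (g := fun _ => ∞) (hN.law_of_infinite C hC h), h]
    simp
  · have hfin := lt_top_iff_ne_top.2 h
    have h1 : ∫⁻ s, N s C ∂P = ∫⁻ s, ENNReal.ofReal ((N s).real C) ∂P := by
      refine lintegral_congr_ae ?_
      filter_upwards [hN.ae_lt_top hC hfin] with s hs
      exact (ENNReal.ofReal_toReal hs.ne).symm
    rw [h1, ← ofReal_integral_eq_lintegral_ofReal
      ((hN.memLp_real hC hfin).integrable (by norm_num))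
      (ae_of_all _ fun s => measureReal_nonneg), hN.integral_real hC hfin]
    exact ENNReal.ofReal_toReal h

/-- The mean measure of a Poisson random measure is its intensity. -/
theorem bind_eq [IsProbabilityMeasure P] (hN : IsPoissonRandomMeasure P ν N) : P.bind N = ν := by
  ext C hC
  rw [Measure.bind_apply hC hN.measurable.aemeasurable, hN.lintegral_apply hC]

/-- Campbell's formula. -/
theorem lintegral_lintegral [IsProbabilityMeasure P] (hN : IsPoissonRandomMeasure P ν N)
    {f : E → ℝ≥0∞} (hf : Measurable f) : ∫⁻ s, ∫⁻ p, f p ∂(N s) ∂P = ∫⁻ p, f p ∂ν := by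
  rw [← Measure.lintegral_bind hN.measurable.aemeasurable hf.aemeasurable, hN.bind_eq]

theorem ae_ae [IsProbabilityMeasure P] (hN : IsPoissonRandomMeasure P ν N) {q : E → Prop}
    (hq : ∀ᵐ p ∂ν, q p) : ∀ᵐ s ∂P, ∀ᵐ p ∂(N s), q p :=
  Measure.ae_ae_of_ae_bind hN.measurable.aemeasurable (by rwa [hN.bind_eq])

theorem measurable_lintegral (hN : IsPoissonRandomMeasure P ν N) {f : E → ℝ≥0∞}
    (hf : Measurable f) : Measurable (fun s => ∫⁻ p, f p ∂(N s)) :=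
  (Measure.measurable_lintegral hf).comp hN.measurable

theorem ae_integrable [IsProbabilityMeasure P] (hN : IsPoissonRandomMeasure P ν N) {f : E → ℝ}
    (hf : Measurable f) (hfi : Integrable f ν) : ∀ᵐ s ∂P, Integrable f (N s) := by
  have h : ∫⁻ s, ∫⁻ p, ‖f p‖ₑ ∂(N s) ∂P ≠ ∞ := by
    rw [hN.lintegral_lintegral hf.enorm]
    exact hfi.2.ne
  filter_upwards [MeasureTheory.ae_lt_top (hN.measurable_lintegral hf.enorm) h] with s hs
  exact ⟨hf.aestronglyMeasurable, hs⟩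

/-- Lower integrals against N are measurable in s; the Bochner integral is their difference wherever
f is integrable. -/
theorem aemeasurable_integral (hN : IsPoissonRandomMeasure P ν N) {f : E → ℝ}
    (hf : Measurable f) (hfi : ∀ᵐ s ∂P, Integrable f (N s)) :
    AEMeasurable (fun s => ∫ p, f p ∂(N s)) P := by
  refine ⟨fun s => (∫⁻ p, .ofReal (f p) ∂(N s)).toReal - (∫⁻ p, .ofReal (-f p) ∂(N s)).toReal,
    ?_, ?_⟩
  · exact (hN.measurable_lintegral hf.ennreal_ofReal).ennreal_toReal.sub
      (hN.measurable_lintegral hf.neg.ennreal_ofReal).ennreal_toReal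
  · filter_upwards [hfi] with s hs
    exact integral_eq_lintegral_pos_part_sub_lintegral_neg_part hs

/-- Counts are almost surely integers, so a nonzero count is at least 1 and Markov's inequality
applies. -/
theorem measure_ne_zero_le [IsProbabilityMeasure P] (hN : IsPoissonRandomMeasure P ν N)
    {C : Set E} (hC : MeasurableSet C) (hfin : ν C < ∞) : P {s | N s C ≠ 0} ≤ ν C := by
  have h : ∀ᵐ x ∂(P.map (fun s => N s C)), x ≠ 0 → 1 ≤ x := by
    rw [hN.law_of_finite C hC hfin, ae_map_iff (by fun_prop) (by
      simp only [ne_eq, imp_iff_not_or, not_not]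
      exact (measurableSet_singleton 0).union measurableSet_Ici)]
    refine ae_of_all _ fun k hk => ?_
    simp only [ne_eq, Nat.cast_eq_zero] at hk
    exact_mod_cast Nat.one_le_iff_ne_zero.2 hk
  have h' := ae_of_ae_map (hN.measurable_apply C hC).aemeasurable h
  calc P {s | N s C ≠ 0} ≤ P {s | 1 ≤ N s C} := measure_mono_ae h'
    _ ≤ ∫⁻ s, N s C ∂P := by
      simpa using mul_meas_ge_le_lintegral (μ := P) (hN.measurable_apply C hC) 1
    _ = ν C := hN.lintegral_apply hC

/-- A measurable function is almost surely integrable over a set of finite intensity. -/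
theorem ae_integrableOn_of_finite [IsProbabilityMeasure P] (hN : IsPoissonRandomMeasure P ν N)
    {f : E → ℝ} (hf : Measurable f) {C : Set E} (hC : MeasurableSet C) (hfin : ν C < ∞) :
    ∀ᵐ s ∂P, IntegrableOn f C (N s) := by
  -- The intensity of {|f| > n} inside C tends to 0, so almost surely some `D n` receives no point.
  -- Then f is bounded by n at the finitely many points of C.
  set D : ℕ → Set E := fun n => C ∩ {p | (n : ℝ) < |f p|} with hD
  have hDm : ∀ n, MeasurableSet (D n) := fun n =>
    hC.inter (measurableSet_lt measurable_const hf.abs)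
  have hDfin : ∀ n, ν (D n) < ∞ := fun n => (measure_mono inter_subset_left).trans_lt hfin
  have hanti : Antitone D := by
    intro m n hmn p hp
    simp only [hD, mem_inter_iff, mem_ofPred_eq] at hp ⊢
    exact ⟨hp.1, lt_of_le_of_lt (Nat.cast_le.2 hmn) hp.2⟩
  have hempty : ⋂ n, D n = ∅ := by
    refine eq_empty_of_forall_notMem fun p hp => ?_
    obtain ⟨n, hn⟩ := exists_nat_gt |f p|
    have h := mem_iInter.1 hp n
    simp only [hD, mem_inter_iff, mem_ofPred_eq] at h
    exact lt_asymm hn h.2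
  have hlim : Tendsto (fun n => ν (D n)) atTop (𝓝 0) := by
    have := tendsto_measure_iInter_atTop (μ := ν) (fun n => (hDm n).nullMeasurableSet) hanti
      ⟨0, (hDfin 0).ne⟩
    rwa [hempty, measure_empty] at this
  have hae : ∀ᵐ s ∂P, ∃ n, N s (D n) = 0 := by
    rw [ae_iff]
    refine le_antisymm (ge_of_tendsto' hlim fun n => ?_) zero_le
    refine (measure_mono ?_).trans (hN.measure_ne_zero_le (hDm n) (hDfin n))
    intro s hs
    simp only [not_exists, mem_ofPred_eq] at hs
    exact hs n
  filter_upwards [hae, hN.ae_lt_top hC hfin] with s ⟨n, hn⟩ hs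
  refine Measure.integrableOn_of_bounded (M := n) hs.ne hf.aestronglyMeasurable ?_
  rw [ae_restrict_iff' hC]
  filter_upwards [measure_eq_zero_iff_ae_notMem.1 hn] with p hp hpC
  by_contra hlt
  exact hp ⟨hpC, not_le.1 hlt⟩

/-- The compensated integral of a simple function satisfies the Itô isometry. -/
theorem lintegral_simpleFunc_sq [IsProbabilityMeasure P] (hN : IsPoissonRandomMeasure P ν N)
    (f : SimpleFunc E ℝ) (hf : Integrable f ν) :
    ∫⁻ s, ENNReal.ofReal ((∫ p, f p ∂(N s) - ∫ p, f p ∂ν) ^ 2) ∂P =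
      ∫⁻ p, ENNReal.ofReal (f p ^ 2) ∂ν := by
  have hfin : ∀ y : ℝ, y ≠ 0 → ν (f ⁻¹' {y}) < ∞ := fun y hy =>
    SimpleFunc.measure_preimage_lt_top_of_integrable f hf hy
  set X : ℝ → S → ℝ := fun y s => y * (N s).real (f ⁻¹' {y}) with hX
  -- The fibre over 0 may have infinite intensity, so the value y = 0 is treated separately
  -- throughout.
  have hX0 : X 0 = 0 := by ext; simp [hX]
  have hC : ∀ y, MeasurableSet (f ⁻¹' {y}) := fun y => f.measurableSet_fiber y
  have hmem : ∀ y, MemLp (X y) 2 P := by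
    intro y
    rcases eq_or_ne y 0 with rfl | hy
    · rw [hX0]; exact MemLp.zero
    · exact (hN.memLp_real (hC y) (hfin y hy)).const_mul y
  have hmean : ∀ y, ∫ s, X y s ∂P = y * ν.real (f ⁻¹' {y}) := by
    intro y
    rcases eq_or_ne y 0 with rfl | hy
    · simp [hX]
    · rw [integral_const_mul, hN.integral_real (hC y) (hfin y hy)]
  have hvar : ∀ y, variance (X y) P = y ^ 2 * ν.real (f ⁻¹' {y}) := by
    intro y
    rcases eq_or_ne y 0 with rfl | hy
    · rw [hX0]; simp
    · rw [variance_const_mul, hN.variance_real (hC y) (hfin y hy)]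
  have hind : (f.range : Set ℝ).Pairwise fun i j => X i ⟂ᵢ[P] X j := by
    intro a ha b hb hab
    have h := hN.indep 2 ![f ⁻¹' {a}, f ⁻¹' {b}] (by
      intro i; fin_cases i <;> simp [hC]) (by
      have hd : Disjoint (f ⁻¹' {a}) (f ⁻¹' {b}) :=
        Disjoint.preimage f (by simpa using hab)
      intro i j hij
      fin_cases i <;> fin_cases j <;> simp_all [hd.symm])
    have h2 : IndepFun (fun s => N s (f ⁻¹' {a})) (fun s => N s (f ⁻¹' {b})) P :=
      h.indepFun (i := 0) (j := 1) (by decide)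
    exact h2.comp (φ := fun x => a * x.toReal) (ψ := fun x => b * x.toReal)
      (by fun_prop) (by fun_prop)
  have hsum : MemLp (∑ y ∈ f.range, X y) 2 P := memLp_finsetSum' _ fun y _ => hmem y
  -- Subtracting the ν-integral is exactly centring, so the left side becomes a variance, additive
  -- over the independent fibres.
  have hEν : ∫ p, f p ∂ν = ∫ s, (∑ y ∈ f.range, X y) s ∂P := by
    rw [f.integral_eq_sum hf]
    simp only [Finset.sum_apply]
    rw [integral_finsetSum _ fun y _ => (hmem y).integrable (by norm_num)]
    exact Finset.sum_congr rfl fun y _ => by rw [hmean, smul_eq_mul, mul_comm]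
  have h1 : ∫⁻ s, ENNReal.ofReal ((∫ p, f p ∂(N s) - ∫ p, f p ∂ν) ^ 2) ∂P =
      evariance (∑ y ∈ f.range, X y) P := by
    rw [evariance_eq_lintegral_ofReal]
    refine lintegral_congr_ae ?_
    filter_upwards [hN.ae_integrable f.measurable hf] with s hs
    rw [← hEν, f.integral_eq_sum hs]
    simp [hX, mul_comm]
  rw [h1, ← ofReal_variance hsum, IndepFun.variance_sum (fun y _ => hmem y) hind,
    ENNReal.ofReal_sum_of_nonneg fun y _ => variance_nonneg _ _]
  have h2 : ∫⁻ p, ENNReal.ofReal (f p ^ 2) ∂ν =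
      ∑ y ∈ f.range, ENNReal.ofReal (y ^ 2) * ν (f ⁻¹' {y}) := by
    rw [← SimpleFunc.map_lintegral (fun y => ENNReal.ofReal (y ^ 2)) f,
      ← SimpleFunc.lintegral_eq_lintegral]
    rfl
  rw [h2]
  refine Finset.sum_congr rfl fun y _ => ?_
  rw [hvar, ENNReal.ofReal_mul (sq_nonneg _)]
  rcases eq_or_ne y 0 with rfl | hy
  · simp
  · rw [Measure.real, ENNReal.ofReal_toReal (hfin y hy).ne]

end IsPoissonRandomMeasure

/-! ### The gauge |x| ∧ x². -/

section LinQuad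

/-- The gauge `|x| ∧ x²` of the Musielak-Orlicz space of compensated integrands. -/
noncomputable def linQuad (x : ℝ) : ℝ := min |x| (|x| ^ 2)

theorem linQuad_nonneg (x : ℝ) : 0 ≤ linQuad x := le_min (abs_nonneg x) (sq_nonneg _)

theorem linQuad_zero : linQuad 0 = 0 := by simp [linQuad]

theorem linQuad_neg (x : ℝ) : linQuad (-x) = linQuad x := by simp [linQuad]

theorem linQuad_le_abs (x : ℝ) : linQuad x ≤ |x| := min_le_left _ _

theorem linQuad_of_one_le {x : ℝ} (hx : 1 ≤ |x|) : linQuad x = |x| :=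
  min_eq_left (by nlinarith)

theorem linQuad_of_le_one {x : ℝ} (hx : |x| ≤ 1) : linQuad x = x ^ 2 := by
  rw [linQuad, sq_abs]
  exact min_eq_right (by rw [← sq_abs]; nlinarith [abs_nonneg x])

theorem measurable_linQuad : Measurable linQuad := by unfold linQuad; fun_prop

theorem linQuad_mono {x y : ℝ} (h : |x| ≤ |y|) : linQuad x ≤ linQuad y :=
  min_le_min h (pow_le_pow_left₀ (abs_nonneg x) h 2)

theorem linQuad_mul_le {c : ℝ} (hc : 1 ≤ c) (x : ℝ) : linQuad (c * x) ≤ c ^ 2 * linQuad x := by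
  have hx := abs_nonneg x
  have hc0 : 0 ≤ c := by linarith
  rw [linQuad, linQuad, mul_min_of_nonneg _ _ (sq_nonneg c), abs_mul, abs_of_nonneg hc0, mul_pow]
  exact min_le_min (mul_le_mul_of_nonneg_right (by nlinarith) hx) le_rfl

/-- A quasi-triangle inequality: |x − y| is at most twice the larger modulus, and doubling costs a
factor 2² = 4. -/
theorem linQuad_sub_le (x y : ℝ) : linQuad (x - y) ≤ 4 * (linQuad x + linQuad y) := by
  have key : ∀ a b : ℝ, |b| ≤ |a| → linQuad (a - b) ≤ 4 * linQuad a := by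
    intro a b hab
    have h1 : |a - b| ≤ |2 * a| := by
      rw [abs_mul, abs_two]
      exact (abs_sub a b).trans (by linarith)
    refine (linQuad_mono h1).trans ((linQuad_mul_le (by norm_num) a).trans (by norm_num))
  have hx := linQuad_nonneg x
  have hy := linQuad_nonneg y
  rcases le_total |y| |x| with h | h
  · linarith [key x y h]
  · have := key y x h
    rw [← neg_sub, linQuad_neg] at this
    linarith

end LinQuad

/-- The integral `∫ f dN - ∫ f dν` against the compensated measure of an integrable `f`. -/
noncomputable def compensatedInt {S E : Type*} [MeasurableSpace E] (ν : Measure E)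
    (N : S → Measure E) (f : E → ℝ) (s : S) : ℝ := ∫ p, f p ∂(N s) - ∫ p, f p ∂ν

/-! ### Continuity in probability of compensated integrals. -/

namespace IsPoissonRandomMeasure

variable {S E : Type*} [MeasurableSpace S] [MeasurableSpace E]
  {P : Measure S} [IsProbabilityMeasure P] {ν : Measure E} {N : S → Measure E}

theorem aemeasurable_compensatedInt (hN : IsPoissonRandomMeasure P ν N) {f : E → ℝ}
    (hf : Measurable f) (hfi : Integrable f ν) : AEMeasurable (compensatedInt ν N f) P :=
  (hN.aemeasurable_integral hf (hN.ae_integrable hf hfi)).sub_const _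

theorem compensatedInt_sub (hN : IsPoissonRandomMeasure P ν N) {f g : E → ℝ}
    (hf : Measurable f) (hfi : Integrable f ν) (hg : Measurable g) (hgi : Integrable g ν) :
    ∀ᵐ s ∂P, compensatedInt ν N (fun p => f p - g p) s =
      compensatedInt ν N f s - compensatedInt ν N g s := by
  filter_upwards [hN.ae_integrable hf hfi, hN.ae_integrable hg hgi] with s h1 h2
  simp only [compensatedInt]
  rw [integral_sub h1 h2, integral_sub hfi hgi]
  ring

theorem lintegral_enorm_compensatedInt_le (hN : IsPoissonRandomMeasure P ν N) {f : E → ℝ}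
    (hf : Measurable f) : ∫⁻ s, ‖compensatedInt ν N f s‖ₑ ∂P ≤ 2 * ∫⁻ p, ‖f p‖ₑ ∂ν := by
  calc ∫⁻ s, ‖compensatedInt ν N f s‖ₑ ∂P
      ≤ ∫⁻ s, (∫⁻ p, ‖f p‖ₑ ∂(N s) + ∫⁻ p, ‖f p‖ₑ ∂ν) ∂P := by
        refine lintegral_mono fun s => (enorm_sub_le).trans ?_
        exact add_le_add (enorm_integral_le_lintegral_enorm _) (enorm_integral_le_lintegral_enorm _)
    _ = 2 * ∫⁻ p, ‖f p‖ₑ ∂ν := by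
        rw [lintegral_add_right _ measurable_const, hN.lintegral_lintegral hf.enorm]
        simp [two_mul]

/-- Fatou's lemma along simple approximations. The constant 4 comes from the domination |F n| ≤
2|f|; it is not sharp, but any constant suffices. The right side may be infinite. -/
theorem lintegral_compensatedInt_sq_le (hN : IsPoissonRandomMeasure P ν N) {f : E → ℝ}
    (hf : Measurable f) (hfi : Integrable f ν) :
    ∫⁻ s, ENNReal.ofReal (compensatedInt ν N f s ^ 2) ∂P ≤
      4 * ∫⁻ p, ENNReal.ofReal (f p ^ 2) ∂ν := by
  set F : ℕ → SimpleFunc E ℝ := fun n => SimpleFunc.approxOn f hf univ 0 (mem_univ 0) n with hF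
  have hbd : ∀ n p, ‖F n p‖ ≤ ‖2 * f p‖ := fun n p => by
    rw [norm_mul, Real.norm_two, two_mul]
    exact SimpleFunc.norm_approxOn_zero_le hf (mem_univ 0) p n
  have hlim : ∀ p, Tendsto (fun n => F n p) atTop (𝓝 (f p)) := fun p =>
    SimpleFunc.tendsto_approxOn hf (mem_univ 0) (by simp)
  have hFi : ∀ n, Integrable (F n) ν := fun n =>
    (hfi.const_mul 2).mono (F n).measurable.aestronglyMeasurable (ae_of_all _ (hbd n))
  have hDCT : ∀ μ : Measure E, Integrable f μ →
      Tendsto (fun n => ∫ p, F n p ∂μ) atTop (𝓝 (∫ p, f p ∂μ)) := fun μ hμ =>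
    tendsto_integral_of_dominated_convergence (fun p => ‖2 * f p‖)
      (fun n => (F n).measurable.aestronglyMeasurable) (hμ.const_mul 2).norm
      (fun n => ae_of_all _ (hbd n)) (ae_of_all _ hlim)
  have hae : ∀ᵐ s ∂P, Tendsto (fun n => ENNReal.ofReal (compensatedInt ν N (F n) s ^ 2)) atTop
      (𝓝 (ENNReal.ofReal (compensatedInt ν N f s ^ 2))) := by
    filter_upwards [hN.ae_integrable hf hfi] with s hs
    exact (ENNReal.continuous_ofReal.tendsto _).comp (((hDCT _ hs).sub (hDCT _ hfi)).pow 2)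
  calc ∫⁻ s, ENNReal.ofReal (compensatedInt ν N f s ^ 2) ∂P
      = ∫⁻ s, liminf (fun n => ENNReal.ofReal (compensatedInt ν N (F n) s ^ 2)) atTop ∂P := by
        refine lintegral_congr_ae ?_
        filter_upwards [hae] with s hs using hs.liminf_eq.symm
    _ ≤ liminf (fun n => ∫⁻ s, ENNReal.ofReal (compensatedInt ν N (F n) s ^ 2) ∂P) atTop :=
        lintegral_liminf_le' fun n =>
          ((hN.aemeasurable_compensatedInt (F n).measurable (hFi n)).pow_const 2).ennreal_ofReal
    _ ≤ liminf (fun _ : ℕ => 4 * ∫⁻ p, ENNReal.ofReal (f p ^ 2) ∂ν) atTop := by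
        refine liminf_le_liminf (Eventually.of_forall fun n => ?_)
        have h := hN.lintegral_simpleFunc_sq (F n) (hFi n)
        refine h.le.trans ?_
        rw [← lintegral_const_mul _ (by fun_prop)]
        refine lintegral_mono fun p => ?_
        rw [show (4 : ℝ≥0∞) = ENNReal.ofReal 4 by simp, ← ENNReal.ofReal_mul (by norm_num)]
        refine ENNReal.ofReal_le_ofReal ?_
        have h2 := sq_le_sq.2 (hbd n p)
        rwa [mul_pow, show (2 : ℝ) ^ 2 = 4 by norm_num] at h2
    _ = 4 * ∫⁻ p, ENNReal.ofReal (f p ^ 2) ∂ν := by simp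

/-- The tail of a compensated integral is controlled by the gauge of its integrand. -/
theorem exists_tail_le (hN : IsPoissonRandomMeasure P ν N) {δ : ℝ} (hδ : 0 < δ) :
    ∃ C : ℝ≥0∞, C ≠ ∞ ∧ ∀ u : E → ℝ, Measurable u → Integrable u ν →
      P {s | δ ≤ |compensatedInt ν N u s|} ≤ C * ∫⁻ p, ENNReal.ofReal (linQuad (u p)) ∂ν := by
  have hδ1 : ENNReal.ofReal (δ / 2) ≠ 0 := by simpa using hδ
  have hδ2 : ENNReal.ofReal ((δ / 2) ^ 2) ≠ 0 := by simpa using by positivity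
  -- The first term is Markov's constant for the values above 1, the second Chebyshev's for those at
  -- most 1, each allowed half of δ.
  refine ⟨2 / ENNReal.ofReal (δ / 2) + 4 / ENNReal.ofReal ((δ / 2) ^ 2),
    ENNReal.add_ne_top.2 ⟨ENNReal.div_ne_top (by simp) hδ1, ENNReal.div_ne_top (by simp) hδ2⟩,
    fun u hu hui => ?_⟩
  set M := ∫⁻ p, ENNReal.ofReal (linQuad (u p)) ∂ν
  set A : Set E := {p | |u p| ≤ 1} with hA
  have hAm : MeasurableSet A := measurableSet_le hu.abs measurable_const
  set v : E → ℝ := A.indicator u with hv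
  set w : E → ℝ := Aᶜ.indicator u with hw
  have hvm : Measurable v := hu.indicator hAm
  have hwm : Measurable w := hu.indicator hAm.compl
  have hvi : Integrable v ν := hui.indicator hAm
  have hwi : Integrable w ν := hui.indicator hAm.compl
  have hsub : w = fun p => u p - v p := by
    ext p
    by_cases hp : p ∈ A <;> simp [hv, hw, hp]
  have hvM : ∫⁻ p, ENNReal.ofReal (v p ^ 2) ∂ν ≤ M := by
    refine lintegral_mono fun p => ENNReal.ofReal_le_ofReal ?_
    by_cases hp : p ∈ A
    · simp only [hv, indicator_of_mem hp]
      exact (linQuad_of_le_one (by simpa [hA] using hp)).ge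
    · simp [hv, hp, linQuad_nonneg]
  have hwM : ∫⁻ p, ‖w p‖ₑ ∂ν ≤ M := by
    refine lintegral_mono fun p => ?_
    rw [Real.enorm_eq_ofReal_abs]
    refine ENNReal.ofReal_le_ofReal ?_
    by_cases hp : p ∈ A
    · simp [hw, hp, linQuad_nonneg]
    · rw [hw, indicator_of_mem (by exact hp)]
      refine (linQuad_of_one_le (le_of_lt ?_)).ge
      simpa [hA] using hp
  have hPw : P {s | δ / 2 ≤ |compensatedInt ν N w s|} ≤ 2 / ENNReal.ofReal (δ / 2) * M := by
    calc P {s | δ / 2 ≤ |compensatedInt ν N w s|}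
        ≤ P {s | ENNReal.ofReal (δ / 2) ≤ ‖compensatedInt ν N w s‖ₑ} := by
          refine measure_mono fun s hs => ?_
          simp only [mem_ofPred_eq, Real.enorm_eq_ofReal_abs] at hs ⊢
          exact ENNReal.ofReal_le_ofReal hs
      _ ≤ (∫⁻ s, ‖compensatedInt ν N w s‖ₑ ∂P) / ENNReal.ofReal (δ / 2) :=
          meas_ge_le_lintegral_div (hN.aemeasurable_compensatedInt hwm hwi).enorm hδ1 (by simp)
      _ ≤ (2 * M) / ENNReal.ofReal (δ / 2) := by
          gcongr
          exact (hN.lintegral_enorm_compensatedInt_le hwm).trans (by gcongr)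
      _ = 2 / ENNReal.ofReal (δ / 2) * M := by
          exact ENNReal.mul_div_right_comm
  have hPv : P {s | δ / 2 ≤ |compensatedInt ν N v s|} ≤
      4 / ENNReal.ofReal ((δ / 2) ^ 2) * M := by
    calc P {s | δ / 2 ≤ |compensatedInt ν N v s|}
        ≤ P {s | ENNReal.ofReal ((δ / 2) ^ 2) ≤
            ENNReal.ofReal (compensatedInt ν N v s ^ 2)} := by
          refine measure_mono fun s hs => ?_
          simp only [mem_ofPred_eq] at hs ⊢
          rw [← sq_abs (compensatedInt ν N v s)]
          exact ENNReal.ofReal_le_ofReal (pow_le_pow_left₀ (by positivity) hs 2)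
      _ ≤ (∫⁻ s, ENNReal.ofReal (compensatedInt ν N v s ^ 2) ∂P) /
            ENNReal.ofReal ((δ / 2) ^ 2) :=
          meas_ge_le_lintegral_div
            ((hN.aemeasurable_compensatedInt hvm hvi).pow_const 2).ennreal_ofReal hδ2 (by simp)
      _ ≤ (4 * M) / ENNReal.ofReal ((δ / 2) ^ 2) := by
          gcongr
          exact (hN.lintegral_compensatedInt_sq_le hvm hvi).trans (by gcongr)
      _ = 4 / ENNReal.ofReal ((δ / 2) ^ 2) * M := by
          exact ENNReal.mul_div_right_comm
  have hle : P {s | δ ≤ |compensatedInt ν N u s|} ≤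
      P ({s | δ / 2 ≤ |compensatedInt ν N w s|} ∪ {s | δ / 2 ≤ |compensatedInt ν N v s|}) := by
    refine measure_mono_ae ?_
    have h := hN.compensatedInt_sub hu hui hvm hvi
    rw [← hsub] at h
    filter_upwards [h] with s hs hsu
    change δ / 2 ≤ |compensatedInt ν N w s| ∨ δ / 2 ≤ |compensatedInt ν N v s|
    change δ ≤ |compensatedInt ν N u s| at hsu
    by_contra! hcon
    have h3 := abs_add_le (compensatedInt ν N w s) (compensatedInt ν N v s)
    rw [hs, sub_add_cancel, ← hs] at h3
    linarith [hcon.1, hcon.2]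
  refine hle.trans ((measure_union_le _ _).trans ?_)
  rw [add_mul]
  exact add_le_add hPw hPv

/-- Continuity in probability of the compensated integral. -/
theorem tendstoInMeasure_compensatedInt (hN : IsPoissonRandomMeasure P ν N) {f : E → ℝ}
    (hf : Measurable f) {Y : S → ℝ} (hY : IsCompensatedIntegral P ν N f Y) {ι : Type*}
    {l : Filter ι} {u : ι → E → ℝ} (hum : ∀ᶠ i in l, Measurable (u i))
    (hui : ∀ᶠ i in l, Integrable (u i) ν)
    (hlim : Tendsto (fun i => ∫⁻ p, ENNReal.ofReal (linQuad (f p - u i p)) ∂ν) l (𝓝 0)) :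
    TendstoInMeasure P (fun i => compensatedInt ν N (u i)) l Y := by
  obtain ⟨-, g, hgm, hgi, hg, hgY⟩ := hY
  rw [tendstoInMeasure_iff_norm] at hgY ⊢
  intro δ hδ
  obtain ⟨C, hC, hCle⟩ := hN.exists_tail_le (half_pos hδ)
  have hbound : ∀ᶠ i in l, P {s | δ ≤ ‖compensatedInt ν N (u i) s - Y s‖} ≤
      C * (4 * ∫⁻ p, ENNReal.ofReal (linQuad (f p - u i p)) ∂ν) := by
    filter_upwards [hum, hui] with i him hii
    set a := ∫⁻ p, ENNReal.ofReal (linQuad (f p - u i p)) ∂ν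
    -- Compare with the sequence defining Y. With i fixed, letting n → ∞ removes both terms in `g
    -- n`.
    have hle : ∀ n, P {s | δ ≤ ‖compensatedInt ν N (u i) s - Y s‖} ≤
        C * (4 * (a + ∫⁻ p, ENNReal.ofReal (linQuad (f p - g n p)) ∂ν)) +
          P {s | δ / 2 ≤ ‖compensatedInt ν N (g n) s - Y s‖} := by
      intro n
      have h1 : P {s | δ ≤ ‖compensatedInt ν N (u i) s - Y s‖} ≤
          P ({s | δ / 2 ≤ |compensatedInt ν N (fun p => u i p - g n p) s|} ∪
            {s | δ / 2 ≤ ‖compensatedInt ν N (g n) s - Y s‖}) := by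
        refine measure_mono_ae ?_
        filter_upwards [hN.compensatedInt_sub him hii (hgm n) (hgi n)] with s hs hsu
        change δ / 2 ≤ |compensatedInt ν N (fun p => u i p - g n p) s| ∨
          δ / 2 ≤ ‖compensatedInt ν N (g n) s - Y s‖
        change δ ≤ ‖compensatedInt ν N (u i) s - Y s‖ at hsu
        by_contra! hcon
        rw [hs] at hcon
        have h3 := abs_add_le (compensatedInt ν N (u i) s - compensatedInt ν N (g n) s)
          (compensatedInt ν N (g n) s - Y s)
        rw [sub_add_sub_cancel] at h3
        rw [Real.norm_eq_abs] at hsu hcon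
        linarith [hcon.1, hcon.2]
      refine h1.trans ((measure_union_le _ _).trans (add_le_add_left ?_ _))
      refine (hCle _ (him.sub (hgm n)) (hii.sub (hgi n))).trans ?_
      gcongr
      have hmeas : Measurable fun p => ENNReal.ofReal (linQuad (f p - u i p)) :=
        (measurable_linQuad.comp (hf.sub him)).ennreal_ofReal
      rw [← lintegral_add_left hmeas, ← lintegral_const_mul' _ _ (by simp)]
      refine lintegral_mono fun p => ?_
      rw [← ENNReal.ofReal_add (linQuad_nonneg _) (linQuad_nonneg _),
        show (4 : ℝ≥0∞) = ENNReal.ofReal 4 by simp, ← ENNReal.ofReal_mul (by norm_num)]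
      refine ENNReal.ofReal_le_ofReal ?_
      rw [Pi.sub_apply, show u i p - g n p = (f p - g n p) - (f p - u i p) by ring]
      linarith [linQuad_sub_le (f p - g n p) (f p - u i p)]
    have hlim' : Tendsto (fun n =>
        C * (4 * (a + ∫⁻ p, ENNReal.ofReal (linQuad (f p - g n p)) ∂ν)) +
          P {s | δ / 2 ≤ ‖compensatedInt ν N (g n) s - Y s‖}) atTop
        (𝓝 (C * (4 * (a + 0)) + 0)) := by
      refine Tendsto.add ?_ (hgY (δ / 2) (half_pos hδ))
      refine ENNReal.Tendsto.const_mul ?_ (Or.inr hC)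
      refine ENNReal.Tendsto.const_mul ?_ (Or.inr (by simp))
      exact tendsto_const_nhds.add hg
    simpa using ge_of_tendsto' hlim' hle
  refine tendsto_of_tendsto_of_tendsto_of_le_of_le' tendsto_const_nhds ?_
    (Eventually.of_forall fun _ => zero_le) hbound
  have h := ENNReal.Tendsto.const_mul (a := C)
    (ENNReal.Tendsto.const_mul (a := 4) hlim (Or.inr (by simp))) (Or.inr hC)
  simpa using h

/-- A measurable `f` with `∫ (1 ∧ |f|) dν < ∞` is almost surely integrable. -/
theorem ae_integrable_of_lintegral_min (hN : IsPoissonRandomMeasure P ν N) {f : E → ℝ}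
    (hf : Measurable f) (hfin : ∫⁻ p, ENNReal.ofReal (min 1 |f p|) ∂ν < ∞) :
    ∀ᵐ s ∂P, Integrable f (N s) := by
  -- Where |f| ≥ 1 the intensity is finite, and elsewhere f is ν-integrable.
  set A : Set E := {p | 1 ≤ |f p|} with hA
  have hAm : MeasurableSet A := measurableSet_le measurable_const hf.abs
  have hνA : ν A < ∞ := by
    refine lt_of_le_of_lt ?_ hfin
    rw [← lintegral_indicator_one hAm]
    refine lintegral_mono fun p => ?_
    by_cases hp : p ∈ A
    · have h1 : 1 ≤ |f p| := by simpa [hA] using hp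
      simp [hp, h1]
    · simp [hp]
  have hi : Integrable (Aᶜ.indicator f) ν := by
    refine ⟨(hf.indicator hAm.compl).aestronglyMeasurable, lt_of_le_of_lt ?_ hfin⟩
    refine lintegral_mono fun p => ?_
    rw [Real.enorm_eq_ofReal_abs]
    refine ENNReal.ofReal_le_ofReal ?_
    by_cases hp : p ∈ A
    · simp [hp]
    · have h1 : |f p| < 1 := by simpa [hA] using hp
      simp [hp, h1.le]
  filter_upwards [hN.ae_integrableOn_of_finite hf hAm hνA,
    hN.ae_integrable (hf.indicator hAm.compl) hi] with s h1 h2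
  rw [integrable_indicator_iff hAm.compl] at h2
  have := h1.union h2
  rwa [union_compl_self, integrableOn_univ] at this

end IsPoissonRandomMeasure

/-! ### Existence of the compensated integral by cutting off small values. -/

section LargePart

variable {E : Type*}

/-- The part of `f` exceeding `a` in absolute value. -/
noncomputable def largePart (f : E → ℝ) (a : ℝ) : E → ℝ :=
  {p | a < |f p|}.indicator f

theorem largePart_of_lt {f : E → ℝ} {a : ℝ} {p : E} (h : a < |f p|) :
    largePart f a p = f p := indicator_of_mem (s := {p | a < |f p|}) h f

theorem largePart_of_le {f : E → ℝ} {a : ℝ} {p : E} (h : |f p| ≤ a) :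
    largePart f a p = 0 := indicator_of_notMem (s := {p | a < |f p|}) (not_lt.2 h) f

theorem measurable_largePart [MeasurableSpace E] {f : E → ℝ} (hf : Measurable f) (a : ℝ) :
    Measurable (largePart f a) :=
  hf.indicator (measurableSet_lt measurable_const hf.abs)

/-- For |x| > a and a ≤ 1, both |x| and x² are at least a|x|, so the gauge dominates. -/
theorem integrable_largePart [MeasurableSpace E] {ν : Measure E} {f : E → ℝ} (hf : Measurable f)
    (hfin : ∫⁻ p, ENNReal.ofReal (linQuad (f p)) ∂ν < ∞) {a : ℝ} (ha : 0 < a) (ha1 : a ≤ 1) :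
    Integrable (largePart f a) ν := by
  have hq : Integrable (fun p => a⁻¹ * linQuad (f p)) ν := by
    refine Integrable.const_mul ⟨(measurable_linQuad.comp hf).aestronglyMeasurable, ?_⟩ _
    rw [hasFiniteIntegral_iff_norm]
    simpa [Real.norm_eq_abs, abs_of_nonneg (linQuad_nonneg _)] using hfin
  refine hq.mono' (measurable_largePart hf a).aestronglyMeasurable (ae_of_all _ fun p => ?_)
  rw [Real.norm_eq_abs]
  rcases lt_or_ge a |f p| with h | h
  · rw [largePart_of_lt h, le_inv_mul_iff₀ ha, linQuad]
    exact le_min (mul_le_of_le_one_left (abs_nonneg _) ha1) (by nlinarith)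
  · rw [largePart_of_le h, abs_zero]
    exact mul_nonneg (inv_nonneg.2 ha.le) (linQuad_nonneg _)

end LargePart

namespace IsPoissonRandomMeasure

variable {S E : Type*} [MeasurableSpace S] [MeasurableSpace E]
  {P : Measure S} [IsProbabilityMeasure P] {ν : Measure E} {N : S → Measure E}

/-- The compensated integral exists on the whole Musielak-Orlicz space. -/
theorem exists_isCompensatedIntegral (hN : IsPoissonRandomMeasure P ν N) {f : E → ℝ}
    (hf : Measurable f) (hfin : ∫⁻ p, ENNReal.ofReal (linQuad (f p)) ∂ν < ∞) :
    ∃ Y, IsCompensatedIntegral P ν N f Y := by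
  set a : ℕ → ℝ := fun n => 1 / ((n : ℝ) + 1) with ha
  have ha0 : ∀ n, 0 < a n := fun n => Nat.one_div_pos_of_nat
  have ha1 : ∀ n, a n ≤ 1 := fun n => by
    have := Nat.one_div_le_one_div (α := ℝ) (Nat.zero_le n)
    simpa [ha] using this
  have hanti : Antitone a := fun m n hmn => Nat.one_div_le_one_div hmn
  have halim : Tendsto a atTop (𝓝 0) := tendsto_one_div_add_atTop_nhds_zero_nat
  set g : ℕ → E → ℝ := fun n => largePart f (a n) with hg
  have hgm : ∀ n, Measurable (g n) := fun n => measurable_largePart hf _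
  have hgi : ∀ n, Integrable (g n) ν := fun n => integrable_largePart hf hfin (ha0 n) (ha1 n)
  set A : ℕ → ℝ≥0∞ := fun n => ∫⁻ p, ENNReal.ofReal (linQuad (f p - g n p)) ∂ν with hA
  have hAlim : Tendsto A atTop (𝓝 0) := by
    have h := tendsto_lintegral_of_dominated_convergence (μ := ν)
      (F := fun n p => ENNReal.ofReal (linQuad (f p - g n p))) (f := fun _ => 0)
      (fun p => ENNReal.ofReal (linQuad (f p)))
      (fun n => (measurable_linQuad.comp (hf.sub (hgm n))).ennreal_ofReal)
      (fun n => ae_of_all _ fun p => by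
        refine ENNReal.ofReal_le_ofReal ?_
        rcases lt_or_ge (a n) |f p| with h | h
        · simp [hg, largePart_of_lt h, linQuad_zero, linQuad_nonneg]
        · simp [hg, largePart_of_le h])
      hfin.ne (ae_of_all _ fun p => by
        refine tendsto_const_nhds.congr' ?_
        rcases eq_or_ne (f p) 0 with h0 | h0
        · refine Eventually.of_forall fun n => ?_
          have : g n p = 0 := largePart_of_le (by rw [h0, abs_zero]; exact (ha0 n).le)
          simp [this, h0, linQuad_zero]
        · filter_upwards [halim.eventually_lt_const (abs_pos.2 h0)] with n hn
          simp [hg, largePart_of_lt hn, linQuad_zero])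
    simpa using h
  -- Two cutoffs differ only where |f| ≤ a M ≤ 1, and there the gauge is the square. This makes the
  -- approximations Cauchy in L².
  have hsq : ∀ M m n, M ≤ m → M ≤ n →
      ∫⁻ p, ENNReal.ofReal ((g m p - g n p) ^ 2) ∂ν ≤ A M := by
    intro M m n hm hn
    refine lintegral_mono fun p => ENNReal.ofReal_le_ofReal ?_
    rcases lt_or_ge (a M) |f p| with h | h
    · simp [hg, largePart_of_lt h, largePart_of_lt ((hanti hm).trans_lt h),
        largePart_of_lt ((hanti hn).trans_lt h), linQuad_zero]
    · have h1 : linQuad (f p - g M p) = f p ^ 2 := by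
        simp [hg, largePart_of_le h, linQuad_of_le_one (h.trans (ha1 M))]
      rw [h1]
      have h2 : ∀ k, g k p = f p ∨ g k p = 0 := fun k => by
        rcases lt_or_ge (a k) |f p| with h | h
        · exact Or.inl (largePart_of_lt h)
        · exact Or.inr (largePart_of_le h)
      rcases h2 m with h3 | h3 <;> rcases h2 n with h4 | h4 <;> rw [h3, h4] <;>
        simp [sq_nonneg]
  set X : ℕ → S → ℝ := fun n => compensatedInt ν N (g n) with hX
  have hXm : ∀ n, AEMeasurable (X n) P := fun n => hN.aemeasurable_compensatedInt (hgm n) (hgi n)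
  have hXle : ∀ M m n, M ≤ m → M ≤ n →
      eLpNorm (X m - X n) 2 P ≤ (4 * A M) ^ (1 / 2 : ℝ) := by
    intro M m n hm hn
    rw [eLpNorm_eq_lintegral_rpow_enorm_toReal (by norm_num) (by norm_num)]
    simp only [ENNReal.toReal_ofNat, ENNReal.rpow_ofNat]
    refine ENNReal.rpow_le_rpow ?_ (by norm_num)
    have h1 : ∫⁻ s, ‖(X m - X n) s‖ₑ ^ 2 ∂P =
        ∫⁻ s, ENNReal.ofReal (compensatedInt ν N (fun p => g m p - g n p) s ^ 2) ∂P := by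
      refine lintegral_congr_ae ?_
      filter_upwards [hN.compensatedInt_sub (hgm m) (hgi m) (hgm n) (hgi n)] with s hs
      rw [hs, ← enorm_pow, Real.enorm_of_nonneg (sq_nonneg _)]
      rfl
    rw [h1]
    refine (hN.lintegral_compensatedInt_sq_le ((hgm m).sub (hgm n)) ((hgi m).sub (hgi n))).trans ?_
    gcongr
    exact hsq M m n hm hn
  have hAfin : ∀ n, A n ≠ ∞ := fun n => by
    refine ((lintegral_mono fun p => ENNReal.ofReal_le_ofReal ?_).trans_lt hfin).ne
    rcases lt_or_ge (a n) |f p| with h | h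
    · simp [hg, largePart_of_lt h, linQuad_zero, linQuad_nonneg]
    · simp [hg, largePart_of_le h]
  have hbfin : ∀ n, (4 * A n) ^ (1 / 2 : ℝ) ≠ ∞ := fun n =>
    ENNReal.rpow_ne_top_of_nonneg (by norm_num) (ENNReal.mul_ne_top (by simp) (hAfin n))
  -- `X n` itself need not be square integrable, since f may have large values only in L¹.
  -- Subtracting `X 0` removes them; it is added back to the L² limit `W`.
  have hmem : ∀ n, MemLp (X n - X 0) 2 P := fun n =>
    ⟨((hXm n).sub (hXm 0)).aestronglyMeasurable,
      (hXle 0 n 0 (Nat.zero_le _) le_rfl).trans_lt (lt_top_iff_ne_top.2 (hbfin 0))⟩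
  set Z : ℕ → Lp ℝ 2 P := fun n => (hmem n).toLp (X n - X 0) with hZ
  have hcauchy : CauchySeq Z := by
    refine cauchySeq_of_le_tendsto_0 (fun n => ((4 * A n) ^ (1 / 2 : ℝ)).toReal) ?_ ?_
    · intro n m M hn hm
      rw [hZ, Lp.dist_edist, Lp.edist_toLp_toLp, sub_sub_sub_cancel_right]
      exact ENNReal.toReal_mono (hbfin M) (hXle M n m hn hm)
    · have h1 : Tendsto (fun n => (4 * A n) ^ (1 / 2 : ℝ)) atTop (𝓝 0) := by
        have h2 := (ENNReal.Tendsto.const_mul (a := 4) hAlim (Or.inr (by simp))).ennrpow_const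
          (1 / 2 : ℝ)
        simpa using h2
      exact (ENNReal.tendsto_toReal (by simp)).comp h1
  obtain ⟨W, hW⟩ := cauchySeq_tendsto_of_complete hcauchy
  have hWX : TendstoInMeasure P (fun n => X n - X 0) atTop W :=
    (tendstoInMeasure_of_tendsto_Lp hW).congr_left fun n => (hmem n).coeFn_toLp
  refine ⟨W + X 0, (Lp.aestronglyMeasurable W).aemeasurable.add (hXm 0), g, hgm, hgi, hAlim, ?_⟩
  rw [tendstoInMeasure_iff_norm] at hWX ⊢
  intro δ hδ
  refine (hWX δ hδ).congr fun n => ?_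
  congr! 4 with s
  change ‖X n s - X 0 s - W s‖ = ‖X n s - (W s + X 0 s)‖
  rw [sub_sub, add_comm]

end IsPoissonRandomMeasure

/-! ### Convergence in probability along a filter. -/

section ConvergenceInMeasure

variable {S ι : Type*} [MeasurableSpace S] {P : Measure S} {l : Filter ι}

/-- Countable generation reduces the claim to sequences. Initial terms are discarded because
measurability holds only eventually along l. -/
theorem tendstoInMeasure_of_tendsto_ae_of_isCountablyGenerated [IsFiniteMeasure P]
    [l.IsCountablyGenerated] {F : ι → S → ℝ} {G : S → ℝ}
    (hF : ∀ᶠ i in l, AEStronglyMeasurable (F i) P)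
    (hFG : ∀ᵐ s ∂P, Tendsto (fun i => F i s) l (𝓝 (G s))) : TendstoInMeasure P F l G := by
  intro ε hε
  refine tendsto_of_seq_tendsto fun x hx => ?_
  obtain ⟨n, hn⟩ := eventually_atTop.1 (hx.eventually hF)
  rw [← tendsto_add_atTop_iff_nat n]
  refine tendstoInMeasure_of_tendsto_ae (f := fun k => F (x (k + n)))
    (fun k => hn _ (Nat.le_add_left _ _)) ?_ ε hε
  filter_upwards [hFG] with s hs
  exact hs.comp (hx.comp (tendsto_add_atTop_nat n))

theorem TendstoInMeasure.add_of_real {F F' : ι → S → ℝ} {G G' : S → ℝ}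
    (h : TendstoInMeasure P F l G) (h' : TendstoInMeasure P F' l G') :
    TendstoInMeasure P (fun i s => F i s + F' i s) l (fun s => G s + G' s) := by
  rw [tendstoInMeasure_iff_norm] at *
  intro ε hε
  have hsum := (h (ε / 2) (half_pos hε)).add (h' (ε / 2) (half_pos hε))
  rw [add_zero] at hsum
  refine tendsto_of_tendsto_of_tendsto_of_le_of_le tendsto_const_nhds hsum
    (fun _ => zero_le) fun i => ?_
  refine (measure_mono fun s hs => ?_).trans (measure_union_le _ _)
  change ε / 2 ≤ ‖F i s - G s‖ ∨ ε / 2 ≤ ‖F' i s - G' s‖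
  change ε ≤ ‖F i s + F' i s - (G s + G' s)‖ at hs
  by_contra! hcon
  rw [add_sub_add_comm] at hs
  linarith [norm_add_le (F i s - G s) (F' i s - G' s), hcon.1, hcon.2]

end ConvergenceInMeasure

/-! ### Bounds on the compensator and integrability of the two integrands. -/

theorem IsBoundedCompensator.exists_bound {h : ℝ → ℝ} (hh : IsBoundedCompensator h) :
    ∃ C : ℝ, 1 ≤ C ∧ (∀ β, |h β| ≤ C) ∧ (∀ β, |β| ≤ 1 → |h β| ≤ C * |β|) ∧
      ∀ β, |β| ≤ 1 → |β - h β| ≤ C * β ^ 2 := by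
  obtain ⟨c, hc⟩ := hh.bounded
  obtain ⟨D, hD⟩ := hh.near_zero.bound
  obtain ⟨δ, hδ, hδD⟩ := Metric.eventually_nhds_iff.1 hD
  have hc0 : 0 ≤ c := (abs_nonneg _).trans (hc 0)
  have hδ2 : 0 < δ ^ 2 := by positivity
  -- D serves for |β| < δ. Beyond that, |β − h β| ≤ c + 1 ≤ (c + 1) β² / δ².
  set M := |D| + (c + 1) / δ ^ 2 with hM
  have hM0 : 0 ≤ M := by positivity
  have hquad : ∀ β, |β| ≤ 1 → |β - h β| ≤ M * β ^ 2 := by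
    intro β hβ
    rcases lt_or_ge |β| δ with hlt | hge
    · have h1 := hδD (y := β) (by simpa using hlt)
      rw [Real.norm_eq_abs, Real.norm_eq_abs, abs_of_nonneg (sq_nonneg β)] at h1
      rw [abs_sub_comm]
      refine h1.trans (mul_le_mul_of_nonneg_right ?_ (sq_nonneg β))
      have : 0 ≤ (c + 1) / δ ^ 2 := by positivity
      linarith [le_abs_self D]
    · have h1 : δ ^ 2 ≤ β ^ 2 := by
        rw [← sq_abs β]; exact pow_le_pow_left₀ hδ.le hge 2
      have h2 : |β - h β| ≤ c + 1 := (abs_sub _ _).trans (by linarith [hc β])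
      have h3 : c + 1 ≤ (c + 1) / δ ^ 2 * β ^ 2 := by
        rw [div_mul_eq_mul_div, le_div_iff₀ hδ2]
        exact mul_le_mul_of_nonneg_left h1 (by linarith)
      have h4 : 0 ≤ |D| * β ^ 2 := by positivity
      rw [hM, add_mul]
      linarith
  refine ⟨1 + c + M, by linarith, fun β => by linarith [hc β], fun β hβ => ?_, fun β hβ => ?_⟩
  · have h1 := hquad β hβ
    have h2 : |h β| ≤ |β| + |β - h β| := by
      have := abs_sub β (β - h β)
      rwa [sub_sub_cancel] at this
    have h3 : β ^ 2 ≤ |β| := by rw [← sq_abs]; nlinarith [abs_nonneg β]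
    nlinarith [abs_nonneg β, mul_nonneg hc0 (abs_nonneg β), mul_le_mul_of_nonneg_left h3 hM0]
  · have h1 := hquad β hβ
    nlinarith [sq_nonneg β, mul_nonneg hc0 (sq_nonneg β)]

theorem le_min_one_sq_of_mem_truncRegion {Ω : Type*} {ε : ℝ} (hε : 0 < ε) {K : Set Ω}
    {p : ℝ × Ω}
    (hp : p ∈ truncRegion ε K) : min 1 (ε ^ 2) ≤ min 1 (p.1 ^ 2) := by
  have h1 : ε < |p.1| := by
    have := hp.1
    rw [mem_compl_iff, mem_Icc, ← abs_le, not_le] at this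
    exact this
  refine min_le_min le_rfl ?_
  rw [← sq_abs p.1]
  exact pow_le_pow_left₀ hε.le h1.le 2

section LevyIntegrable

variable {Ω : Type*} [MeasurableSpace Ω] {ν : Measure (ℝ × Ω)} {φ : Ω → ℝ} {h : ℝ → ℝ}

theorem measurable_drift (hφm : Measurable φ) :
    Measurable fun p : ℝ × Ω => ENNReal.ofReal (min 1 (p.1 ^ 2) * |φ p.2|) := by
  fun_prop

/-- For |β| ≤ 1 the bound |β − h β| ≤ Cβ² reduces to the drift condition. For |β| > 1, use 1 ∧ (x +
y) ≤ (1 ∧ x) + y: βφ falls under the large-jump condition and hφ under the drift one. -/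
theorem LevyIntegrable.lintegral_min_lt_top (hφ : LevyIntegrable ν φ) (hφm : Measurable φ)
    (hh : IsBoundedCompensator h) :
    ∫⁻ p, ENNReal.ofReal (min 1 |(p.1 - h p.1) * φ p.2|) ∂ν < ∞ := by
  obtain ⟨C, hC1, hC, -, hquad⟩ := hh.exists_bound
  have hC0 : 0 ≤ C := by linarith
  set A : Set (ℝ × Ω) := (Icc (-1 : ℝ) 1)ᶜ ×ˢ univ with hA
  have hAm : MeasurableSet A := measurableSet_Icc.compl.prod MeasurableSet.univ
  have hle : ∀ p : ℝ × Ω, ENNReal.ofReal (min 1 |(p.1 - h p.1) * φ p.2|) ≤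
      ENNReal.ofReal C * ENNReal.ofReal (min 1 (p.1 ^ 2) * |φ p.2|) +
        A.indicator (fun p => ENNReal.ofReal (min 1 |p.1 * φ p.2|)) p := by
    rintro ⟨β, ω⟩
    simp only
    rw [← ENNReal.ofReal_mul hC0]
    by_cases hβ : |β| ≤ 1
    · refine le_trans (ENNReal.ofReal_le_ofReal ?_) le_self_add
      have h1 : β ^ 2 ≤ 1 := by rw [← sq_abs]; nlinarith [abs_nonneg β]
      refine (min_le_right _ _).trans ?_
      rw [min_eq_right h1, abs_mul, ← mul_assoc]
      exact mul_le_mul_of_nonneg_right (hquad β hβ) (abs_nonneg _)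
    · have hmem : (β, ω) ∈ A := by simpa [hA, abs_le] using hβ
      rw [indicator_of_mem hmem, ← ENNReal.ofReal_add (by positivity) (by positivity)]
      refine ENNReal.ofReal_le_ofReal ?_
      have h1 : 1 ≤ β ^ 2 := by rw [← sq_abs]; nlinarith [not_le.1 hβ]
      rw [min_eq_left h1, one_mul]
      have h2 : |(β - h β) * φ ω| ≤ |β * φ ω| + C * |φ ω| := by
        rw [sub_mul]
        refine (abs_sub _ _).trans ?_
        rw [abs_mul (h β)]
        gcongr
        exact hC β
      rcases le_total 1 |β * φ ω| with h3 | h3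
      · rw [min_eq_left h3]
        exact (min_le_left _ _).trans (le_add_of_nonneg_left (by positivity))
      · rw [min_eq_right h3]
        exact (min_le_right _ _).trans (by linarith)
  refine (lintegral_mono hle).trans_lt ?_
  rw [lintegral_add_left ((measurable_drift hφm).const_mul _),
    lintegral_const_mul _ (measurable_drift hφm), lintegral_indicator hAm]
  exact ENNReal.add_lt_top.2 ⟨ENNReal.mul_lt_top ENNReal.ofReal_lt_top hφ.drift, hφ.large_jumps⟩

/-- For |β| ≤ 1, |h β| ≤ C|β| reduces to the small-jump condition; for |β| > 1, the gauge is at most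
C|φ|, covered by the drift condition. -/
theorem LevyIntegrable.lintegral_linQuad_lt_top (hφ : LevyIntegrable ν φ) (hφm : Measurable φ)
    (hh : IsBoundedCompensator h) :
    ∫⁻ p, ENNReal.ofReal (linQuad (h p.1 * φ p.2)) ∂ν < ∞ := by
  obtain ⟨C, hC1, hC, hlin, -⟩ := hh.exists_bound
  have hC0 : 0 ≤ C := by linarith
  set A : Set (ℝ × Ω) := Icc (-1 : ℝ) 1 ×ˢ univ with hA
  have hAm : MeasurableSet A := measurableSet_Icc.prod MeasurableSet.univ
  have hle : ∀ p : ℝ × Ω, ENNReal.ofReal (linQuad (h p.1 * φ p.2)) ≤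
      ENNReal.ofReal C * ENNReal.ofReal (min 1 (p.1 ^ 2) * |φ p.2|) +
        ENNReal.ofReal (C ^ 2) *
          A.indicator (fun p => ENNReal.ofReal (linQuad (p.1 * φ p.2))) p := by
    rintro ⟨β, ω⟩
    simp only
    by_cases hβ : |β| ≤ 1
    · have hmem : (β, ω) ∈ A := by simpa [hA, abs_le] using hβ
      rw [indicator_of_mem hmem, ← ENNReal.ofReal_mul (sq_nonneg C)]
      refine le_trans (ENNReal.ofReal_le_ofReal ?_) le_add_self
      refine (linQuad_mono ?_).trans (linQuad_mul_le hC1 (β * φ ω))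
      rw [abs_mul, abs_mul, abs_mul, abs_of_nonneg hC0, ← mul_assoc]
      exact mul_le_mul_of_nonneg_right (hlin β hβ) (abs_nonneg _)
    · rw [← ENNReal.ofReal_mul hC0]
      refine le_trans (ENNReal.ofReal_le_ofReal ?_) le_self_add
      have h1 : 1 ≤ β ^ 2 := by rw [← sq_abs]; nlinarith [not_le.1 hβ]
      rw [min_eq_left h1, one_mul]
      refine (linQuad_le_abs _).trans ?_
      rw [abs_mul]
      exact mul_le_mul_of_nonneg_right (hC β) (abs_nonneg _)
  refine (lintegral_mono hle).trans_lt ?_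
  rw [lintegral_add_left ((measurable_drift hφm).const_mul _),
    lintegral_const_mul _ (measurable_drift hφm), lintegral_const_mul' _ _ ENNReal.ofReal_ne_top,
    lintegral_indicator hAm]
  exact ENNReal.add_lt_top.2 ⟨ENNReal.mul_lt_top ENNReal.ofReal_lt_top hφ.drift,
    ENNReal.mul_lt_top ENNReal.ofReal_lt_top hφ.small_jumps⟩

theorem measurableSet_truncRegion {ε : ℝ} {K : Set Ω} (hK : MeasurableSet K) :
    MeasurableSet (truncRegion ε K) := measurableSet_Icc.compl.prod hK

/-- Off [−ε, ε] the weight 1 ∧ β² is bounded below, so the drift condition controls |φ| there. -/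
theorem LevyIntegrable.integrableOn_truncRegion (hφ : LevyIntegrable ν φ) (hφm : Measurable φ)
    (hh : IsBoundedCompensator h) {ε : ℝ} (hε : 0 < ε) {K : Set Ω} (hK : MeasurableSet K) :
    IntegrableOn (fun p : ℝ × Ω => h p.1 * φ p.2) (truncRegion ε K) ν := by
  obtain ⟨C, hC1, hC, -⟩ := hh.exists_bound
  set a := min 1 (ε ^ 2) with ha
  have ha0 : 0 < a := lt_min one_pos (by positivity)
  have hd : Integrable (fun p : ℝ × Ω => C / a * (min 1 (p.1 ^ 2) * |φ p.2|)) ν := by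
    refine Integrable.const_mul ⟨by fun_prop, ?_⟩ _
    rw [hasFiniteIntegral_iff_ofReal (ae_of_all _ fun p => by positivity)]
    exact hφ.drift
  refine hd.integrableOn.mono'
    ((hh.measurable.comp measurable_fst).mul (hφm.comp measurable_snd)).aestronglyMeasurable ?_
  rw [ae_restrict_iff' (measurableSet_truncRegion hK)]
  refine ae_of_all _ fun p hp => ?_
  have h1 := le_min_one_sq_of_mem_truncRegion hε hp
  rw [Real.norm_eq_abs, abs_mul, ← mul_assoc]
  refine mul_le_mul_of_nonneg_right ((hC _).trans ?_) (abs_nonneg _)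
  rw [div_mul_eq_mul_div, le_div_iff₀ ha0]
  exact mul_le_mul_of_nonneg_left h1 (by linarith)

end LevyIntegrable

namespace IsLocalL2LevyMeasure

variable {Ω : Type*} [TopologicalSpace Ω] [MeasurableSpace Ω] {ν : Measure (ℝ × Ω)}

theorem measure_truncRegion_lt_top (hν : IsLocalL2LevyMeasure ν) {ε : ℝ} (hε : 0 < ε) {K : Set Ω}
    (hK : IsCompact K) (hKm : MeasurableSet K) : ν (truncRegion ε K) < ∞ := by
  have ha0 : 0 < min 1 (ε ^ 2) := lt_min one_pos (by positivity)
  have h1 : ENNReal.ofReal (min 1 (ε ^ 2)) * ν (truncRegion ε K) ≤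
      ∫⁻ p in univ ×ˢ K, ENNReal.ofReal (min 1 (p.1 ^ 2)) ∂ν := by
    calc ENNReal.ofReal (min 1 (ε ^ 2)) * ν (truncRegion ε K)
        = ∫⁻ p in truncRegion ε K, ENNReal.ofReal (min 1 (ε ^ 2)) ∂ν := by
          rw [setLIntegral_const]
      _ ≤ ∫⁻ p in truncRegion ε K, ENNReal.ofReal (min 1 (p.1 ^ 2)) ∂ν :=
          setLIntegral_mono' (measurableSet_truncRegion hKm) fun p hp =>
            ENNReal.ofReal_le_ofReal (le_min_one_sq_of_mem_truncRegion hε hp)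
      _ ≤ _ := lintegral_mono_set (prod_mono (subset_univ _) subset_rfl)
  by_contra htop
  rw [not_lt, top_le_iff] at htop
  rw [htop, ENNReal.mul_top (by simpa using hε.ne')] at h1
  exact (hν.localL2 K hK).not_ge h1

theorem ae_fst_ne_zero (hν : IsLocalL2LevyMeasure ν) : ∀ᵐ p ∂ν, p.1 ≠ 0 := by
  rw [ae_iff]
  convert! hν.zero using 2
  ext p
  simp

end IsLocalL2LevyMeasure

/-! ### Exhaustion by truncation regions and the main theorem. -/

theorem eventually_mem_truncRegion {Ω : Type*} {K : ℝ → Set Ω}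
    (hK_mono : ∀ ε ε', 0 < ε → ε ≤ ε' → K ε' ⊆ K ε)
    (hK_union : ∀ ω, ∃ ε, 0 < ε ∧ ω ∈ K ε) {p : ℝ × Ω} (hp : p.1 ≠ 0) :
    ∀ᶠ ε in 𝓝[>] (0 : ℝ), p ∈ truncRegion ε (K ε) := by
  obtain ⟨ε₀, hε₀, hpK⟩ := hK_union p.2
  filter_upwards [Ioo_mem_nhdsGT (lt_min hε₀ (abs_pos.2 hp))] with ε hε
  refine ⟨?_, hK_mono ε ε₀ hε.1 (hε.2.le.trans (min_le_left _ _)) hpK⟩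
  rw [mem_compl_iff, mem_Icc, ← abs_le, not_le]
  exact hε.2.trans_le (min_le_right _ _)

theorem theorem2 {Ω : Type*} [MetricSpace Ω] [CompleteSpace Ω]
    [TopologicalSpace.SeparableSpace Ω] [MeasurableSpace Ω] [BorelSpace Ω]
    {S : Type*} [MeasurableSpace S] (P : Measure S) [IsProbabilityMeasure P]
    (ν : Measure (ℝ × Ω)) (hν : IsLocalL2LevyMeasure ν)
    (N : S → Measure (ℝ × Ω)) (hN : IsPoissonRandomMeasure P ν N)
    (φ : Ω → ℝ) (hφ_meas : Measurable φ) (hφ : LevyIntegrable ν φ)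
    (K : ℝ → Set Ω) (hK_compact : ∀ ε, 0 < ε → IsCompact (K ε))
    (hK_mono : ∀ ε ε', 0 < ε → ε ≤ ε' → K ε' ⊆ K ε)
    (hK_union : ∀ ω, ∃ ε, 0 < ε ∧ ω ∈ K ε)
    (h : ℝ → ℝ) (hh : IsBoundedCompensator h) :
    -- the approximations are well defined, with finite Lévy measure
    (∀ ε, 0 < ε →
      truncMeasure ν ε (K ε) univ < ∞ ∧
      (∀ᵐ s ∂P, IntegrableOn (fun p : ℝ × Ω => p.1 * φ p.2) (truncRegion ε (K ε)) (N s)) ∧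
      Integrable (fun p : ℝ × Ω => h p.1 * φ p.2) (truncMeasure ν ε (K ε))) ∧
    -- the limit exists, and the approximations converge to it in probability
    (∃ L : S → ℝ, IsLevyField P ν N h φ L) ∧
    ∀ L : S → ℝ, IsLevyField P ν N h φ L →
      TendstoInMeasure P (fun ε s => levyApprox ν N h φ ε (K ε) s) (𝓝[>] 0) L := by
  have hKm : ∀ ε, 0 < ε → MeasurableSet (K ε) := fun ε hε => (hK_compact ε hε).measurableSet
  have hRm : ∀ ε, 0 < ε → MeasurableSet (truncRegion ε (K ε)) := fun ε hε =>
    measurableSet_truncRegion (hKm ε hε)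
  have hRfin : ∀ ε, 0 < ε → ν (truncRegion ε (K ε)) < ∞ := fun ε hε =>
    hν.measure_truncRegion_lt_top hε (hK_compact ε hε) (hKm ε hε)
  have hjump : Measurable fun p : ℝ × Ω => p.1 * φ p.2 := by fun_prop
  have hcomp : Measurable fun p : ℝ × Ω => h p.1 * φ p.2 :=
    (hh.measurable.comp measurable_fst).mul (hφ_meas.comp measurable_snd)
  have hrest : Measurable fun p : ℝ × Ω => (p.1 - h p.1) * φ p.2 :=
    (measurable_fst.sub (hh.measurable.comp measurable_fst)).mul (hφ_meas.comp measurable_snd)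
  have hjump_int : ∀ ε, 0 < ε → ∀ᵐ s ∂P,
      IntegrableOn (fun p : ℝ × Ω => p.1 * φ p.2) (truncRegion ε (K ε)) (N s) := fun ε hε =>
    hN.ae_integrableOn_of_finite hjump (hRm ε hε) (hRfin ε hε)
  have hcomp_int : ∀ ε, 0 < ε →
      IntegrableOn (fun p : ℝ × Ω => h p.1 * φ p.2) (truncRegion ε (K ε)) ν := fun ε hε =>
    hφ.integrableOn_truncRegion hφ_meas hh hε (hKm ε hε)
  have hrest_int : ∀ᵐ s ∂P, Integrable (fun p : ℝ × Ω => (p.1 - h p.1) * φ p.2) (N s) :=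
    hN.ae_integrable_of_lintegral_min hrest (hφ.lintegral_min_lt_top hφ_meas hh)
  have hquad := hφ.lintegral_linQuad_lt_top hφ_meas hh
  refine ⟨fun ε hε => ⟨?_, hjump_int ε hε, hcomp_int ε hε⟩, ?_, ?_⟩
  · rw [truncMeasure, Measure.restrict_apply_univ]
    exact hRfin ε hε
  · obtain ⟨Y, hY⟩ := hN.exists_isCompensatedIntegral hcomp hquad
    exact ⟨_, hrest_int, Y, hY, ae_of_all _ fun s => rfl⟩
  rintro L ⟨-, Y, hY, hL⟩
  set R : ℝ → Set (ℝ × Ω) := fun ε => truncRegion ε (K ε)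
  have hRev : ∀ p : ℝ × Ω, p.1 ≠ 0 → ∀ᶠ ε in 𝓝[>] (0 : ℝ), p ∈ R ε := fun p hp =>
    eventually_mem_truncRegion hK_mono hK_union hp
  -- The truncated integrands differ from hφ by at most hφ itself in gauge, and the difference
  -- eventually vanishes at each point with β ≠ 0.
  have hcompensated : TendstoInMeasure P
      (fun ε => compensatedInt ν N ((R ε).indicator fun p => h p.1 * φ p.2)) (𝓝[>] 0) Y := by
    refine hN.tendstoInMeasure_compensatedInt hcomp hY ?_ ?_ ?_
    · filter_upwards [self_mem_nhdsWithin] with ε hε using hcomp.indicator (hRm ε hε)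
    · filter_upwards [self_mem_nhdsWithin] with ε hε
      exact (hcomp_int ε hε).integrable_indicator (hRm ε hε)
    · have hlim := tendsto_lintegral_filter_of_dominated_convergence (μ := ν) (l := 𝓝[>] (0 : ℝ))
        (F := fun ε p => ENNReal.ofReal (linQuad (h p.1 * φ p.2 -
          (R ε).indicator (fun p => h p.1 * φ p.2) p))) (f := fun _ => 0)
        (fun p => ENNReal.ofReal (linQuad (h p.1 * φ p.2)))
        (by
          filter_upwards [self_mem_nhdsWithin] with ε hε
          exact (measurable_linQuad.comp
            (hcomp.sub (hcomp.indicator (hRm ε hε)))).ennreal_ofReal)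
        (Eventually.of_forall fun ε => ae_of_all _ fun p => by
          refine ENNReal.ofReal_le_ofReal ?_
          by_cases hp : p ∈ R ε
          · simp [hp, linQuad_zero, linQuad_nonneg]
          · simp [hp])
        hquad.ne
        (by
          filter_upwards [hν.ae_fst_ne_zero] with p hp
          refine tendsto_const_nhds.congr' ?_
          filter_upwards [hRev p hp] with ε hε
          simp [hε, linQuad_zero])
      simpa using hlim
  have hjumps : TendstoInMeasure P
      (fun ε s => ∫ p in R ε, (p.1 - h p.1) * φ p.2 ∂(N s)) (𝓝[>] 0)
      (fun s => ∫ p, (p.1 - h p.1) * φ p.2 ∂(N s)) := by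
    refine tendstoInMeasure_of_tendsto_ae_of_isCountablyGenerated ?_ ?_
    · filter_upwards [self_mem_nhdsWithin] with ε hε
      rw [show (fun s => ∫ p in R ε, (p.1 - h p.1) * φ p.2 ∂(N s)) = fun s =>
        ∫ p, (R ε).indicator (fun p => (p.1 - h p.1) * φ p.2) p ∂(N s) from
        funext fun s => (integral_indicator (hRm ε hε)).symm]
      refine (hN.aemeasurable_integral (hrest.indicator (hRm ε hε)) ?_).aestronglyMeasurable
      filter_upwards [hrest_int] with s hs using hs.indicator (hRm ε hε)
    -- Since the mean measure of N is ν, almost surely N has no mass on β = 0 either, which gives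
    -- pointwise convergence N s-almost everywhere.
    · filter_upwards [hrest_int, hN.ae_ae hν.ae_fst_ne_zero] with s hs hs0
      have hlim := tendsto_integral_filter_of_dominated_convergence (μ := N s)
        (l := 𝓝[>] (0 : ℝ))
        (F := fun ε => (R ε).indicator fun p : ℝ × Ω => (p.1 - h p.1) * φ p.2)
        (f := fun p => (p.1 - h p.1) * φ p.2)
        (fun p => ‖(p.1 - h p.1) * φ p.2‖)
        (by
          filter_upwards [self_mem_nhdsWithin] with ε hε
          exact (hrest.indicator (hRm ε hε)).aestronglyMeasurable)
        (Eventually.of_forall fun ε => ae_of_all _ fun p => norm_indicator_le_norm_self _ p)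
        hs.norm
        (by
          filter_upwards [hs0] with p hp
          refine tendsto_const_nhds.congr' ?_
          filter_upwards [hRev p hp] with ε hε
          rw [indicator_of_mem hε])
      refine hlim.congr' ?_
      filter_upwards [self_mem_nhdsWithin] with ε hε
      exact integral_indicator (hRm ε hε)
  refine (TendstoInMeasure.add_of_real hjumps hcompensated).congr' ?_ ?_
  · filter_upwards [self_mem_nhdsWithin] with ε hε
    filter_upwards [hrest_int, hjump_int ε hε] with s h1 h2
    -- Both integrals on the right converge absolutely on the region, so the N-integral of hφ
    -- cancels when the two pieces are added.
    have h3 : ∫ p in R ε, h p.1 * φ p.2 ∂(N s) =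
        ∫ p in R ε, p.1 * φ p.2 ∂(N s) - ∫ p in R ε, (p.1 - h p.1) * φ p.2 ∂(N s) := by
      rw [← integral_sub h2 h1.integrableOn]
      exact integral_congr_ae (ae_of_all _ fun p => by ring)
    rw [compensatedInt, integral_indicator (hRm ε hε), integral_indicator (hRm ε hε), h3]
    simp only [levyApprox, truncMeasure]
    ring
  · filter_upwards [hL] with s hs using hs.symm
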